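/- Consider a dynamic game with a finite player set $\mathcal I$ and times $\mathcal T=\{1,\dots,T\}$. At time $t$ each player $i$ chooses an action $U_t^i$, and $(X_{t+1},Z_t,R_t)=f_t(X_t,U_t,W_t)$ with fixed functions $f_t$, where $X_t$ is the state, $Z_t^i$ is the new information of player $i$ (it contains $U_t^i$), $R_t^i\in[-1,1]$ is the reward of player $i$, and $W_t$ is nature's move. The pair $(X_1,H_1)$, $H_1=(H_1^i)_{i\in\mathcal I}$, and $W_1,\dots,W_T$ are mutually independent with given distributions; all these variables except the rewards take values in finite sets. Player $i$'s information at time $t$ is $H_t^i=(H_1^i,Z_{1:t-1}^i)$, with set of possible values $\mathcal H_t^i$. A behavioral strategy $g^i$ of player $i$ consists of functions $g_t^i:\mathcal H_t^i\to\Delta(\mathcal U_t^i)$, and $J^i(g)=\mathbb E^g[\sum_{t=1}^T R_t^i]$ is the payoff of player $i$ under the profile $g=(g^i)_{i\in\mathcal I}$. A sequential equilibrium is a pair $(g,Q)$ of a behavioral strategy profile and functions $Q_t^i:\mathcal H_t^i\times\mathcal U_t^i\to\mathbb R$ such that (a) $\mathrm{supp}(g_t^i(h_t^i))\subseteq\arg\max_{u}Q_t^i(h_t^i,u)$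 for all $i,t$ and $h_t^i\in\mathcal H_t^i$, and (b) there are pairs $(g^{(n)},Q^{(n)})\to(g,Q)$ such that each $g^{(n)}$ plays every action with positive probability at every information set and $Q^{(n),i}_\tau(h_\tau^i,u_\tau^i)=\mathbb E^{g^{(n)}}\big[\sum_{t=\tau}^T R_t^i\,\big|\,h_\tau^i,u_\tau^i\big]$ for all $i,\tau,h_\tau^i\in\mathcal H_\tau^i,u_\tau^i\in\mathcal U_\tau^i$. Its payoff profile is $(J^i(g))_{i\in\mathcal I}$. For each player $i$ let $K_t^i$ be a compression of $H_t^i$ with values in a finite set $\mathcal K_t^i$ that can be sequentially updated: $K_1^i=\iota_1^i(H_1^i)$ and $K_t^i=\iota_t^i(K_{t-1}^i,Z_{t-1}^i)$ for $t\ge 2$, with fixed functions $\iota_t^i$. $K^i=(K_t^i)_{t\in\mathcal T}$ is called unilaterally sufficient information (USI) for player $i$ if there are functions $F_t^{i,g^i}:\mathcal K_t^i\to\Delta(\mathcal H_t^i)$, depending on the strategies of the players only through $g^i$, and $\Phi_t^{i,g^{-i}}:\mathcal K_t^i\to\Delta(\mathcal X_t\times\mathcal H_t^{-i})$, depending on them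 only through $g^{-i}$, such that $$\Pr\nolimits^{g}(x_t,h_t\mid k_t^i)=F_t^{i,g^i}(h_t^i\mid k_t^i)\,\Phi_t^{i,g^{-i}}(x_t,h_t^{-i}\mid k_t^i)$$ for all behavioral strategy profiles $g$, all $t\in\mathcal T$, all $k_t^i$ with $\Pr^g(k_t^i)>0$, and all $x_t\in\mathcal X_t$, $h_t^j\in\mathcal H_t^j$ ($j\in\mathcal I$). A sequential equilibrium $(g,Q)$ is $K$-based if for every $i$ there are functions $\rho_t^i:\mathcal K_t^i\to\Delta(\mathcal U_t^i)$ with $g_t^i(h_t^i)=\rho_t^i(k_t^i)$ for all $t$ and $h_t^i$, where $k_t^i$ is the compression of $h_t^i$. If $K^i$ is USI for player $i$, for every $i\in\mathcal I$, then the set of payoff profiles of $K$-based sequential equilibria equals the set of payoff profiles of all sequential equilibria. -/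

import Mathlib

open Filter Topology

universe u v

noncomputable section

/-- A finite game with asymmetric information, horizon `T`, and player set `I`. Times are numbered
from `0`, and only the times `t < T` are played (the data at later times are never used).
At time `t` the players choose `U_t`, nature draws `W_t`, and
`(X_{t+1}, Z_t, R_t) = f_t(X_t, U_t, W_t)`; the three components of `f_t` are the functions
`next`, `obs` and `reward`. -/
structure DynGame (I : Type v) (T : ℕ) [Fintype I] [DecidableEq I] where
  /-- states -/
  X : ℕ → Type u
  /-- actions of each player -/
  U : ℕ → I → Type u
  /-- new information of each player -/
  Z : ℕ → I → Type u
  /-- moves of nature -/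
  W : ℕ → Type u
  /-- initial information of each player -/
  H₁ : I → Type u
  [finX : ∀ t, Fintype (X t)]
  [finU : ∀ t i, Fintype (U t i)]
  [finZ : ∀ t i, Fintype (Z t i)]
  [finW : ∀ t, Fintype (W t)]
  [finH : ∀ i, Fintype (H₁ i)]
  /-- joint distribution of the initial state and the initial information -/
  prior : stdSimplex ℝ (X 0 × ∀ i, H₁ i)
  /-- distribution of `W_t` -/
  noise : ∀ t, stdSimplex ℝ (W t)
  next : ∀ t, X t → (∀ i, U t i) → W t → X (t + 1)
  obs : ∀ t, X t → (∀ i, U t i) → W t → ∀ i, Z t i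
  reward : ∀ t, X t → (∀ i, U t i) → W t → I → ℝ
  reward_mem : ∀ t x a w i, reward t x a w i ∈ Set.Icc (-1 : ℝ) 1
  /-- a player's own action is contained in the player's new information -/
  own_action : ∀ t i, ∃ act : Z t i → U t i, ∀ x a w, act (obs t x a w i) = a i

namespace DynGame

attribute [instance] DynGame.finX DynGame.finU DynGame.finZ DynGame.finW DynGame.finH

variable {I : Type v} {T : ℕ} [Fintype I] [DecidableEq I] (G : DynGame.{u, v} I T)

/-- Values of player `i`'s information `H_t^i`: the initial information together with the new
information obtained at the times before `t`. -/
def Hist (i : I) : ℕ → Type u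
  | 0 => G.H₁ i
  | t + 1 => Hist i t × G.Z t i

instance instFintypeHist (i : I) : ∀ t, Fintype (G.Hist i t)
  | 0 => inferInstanceAs (Fintype (G.H₁ i))
  | t + 1 =>
    haveI := instFintypeHist i t
    inferInstanceAs (Fintype (G.Hist i t × G.Z t i))

/-- The realizations of all moves before time `t`: the initial state and the initial
information, followed by the actions and the move of nature at each time before `t`. -/
def Path : ℕ → Type (max u v)
  | 0 => G.X 0 × ∀ i, G.H₁ i
  | t + 1 => Path t × (∀ i, G.U t i) × G.W t

instance instFintypePath : ∀ t, Fintype (G.Path t)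
  | 0 => inferInstanceAs (Fintype (G.X 0 × ∀ i, G.H₁ i))
  | t + 1 =>
    haveI := instFintypePath t
    inferInstanceAs (Fintype (G.Path t × (∀ i, G.U t i) × G.W t))

/-- The state after a path. -/
def stateOf : ∀ t, G.Path t → G.X t
  | 0, ω => ω.1
  | t + 1, ω => G.next t (stateOf t ω.1) ω.2.1 ω.2.2

/-- Player `i`'s information after a path. -/
def histOf (i : I) : ∀ t, G.Path t → G.Hist i t
  | 0, ω => ω.2 i
  | t + 1, ω => (histOf i t ω.1, G.obs t (G.stateOf t ω.1) ω.2.1 ω.2.2 i)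

/-- The sample space: all moves made during the game. -/
abbrev Outcome : Type (max u v) := G.Path T

/-- The part of an outcome that is realized before time `t`. -/
def upTo (t : ℕ) (ht : t ≤ T) (ω : G.Outcome) : G.Path t :=
  Nat.decreasingInduction (motive := fun s _ => G.Path s) (fun _ _ p => p.1) ω ht

/-- The random variable `X_t`. -/
def stateRV (t : Fin T) (ω : G.Outcome) : G.X t := G.stateOf t (G.upTo t t.isLt.le ω)

/-- The random variable `H_t^i`. -/
def histRV (i : I) (t : Fin T) (ω : G.Outcome) : G.Hist i t :=
  G.histOf i t (G.upTo t t.isLt.le ω)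

/-- The random vector `U_t`. -/
def actionRV (t : Fin T) (ω : G.Outcome) : ∀ i, G.U t i := (G.upTo (t + 1) t.isLt ω).2.1

/-- The random variable `W_t`. -/
def noiseRV (t : Fin T) (ω : G.Outcome) : G.W t := (G.upTo (t + 1) t.isLt ω).2.2

/-- The random variable `R_t^i`. -/
def rewardRV (i : I) (t : Fin T) (ω : G.Outcome) : ℝ :=
  G.reward t (G.stateRV t ω) (G.actionRV t ω) (G.noiseRV t ω) i

/-- Behavioral strategies of player `i`. -/
abbrev Strategy (i : I) : Type u := ∀ t : Fin T, G.Hist i t → stdSimplex ℝ (G.U t i)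

/-- Behavioral strategy profiles. -/
abbrev Profile : Type (max u v) := ∀ i, G.Strategy i

/-- Behavioral strategy profiles of the players other than `i`. -/
abbrev OtherProfile (i : I) : Type (max u v) := ∀ j : {j : I // j ≠ i}, G.Strategy j

/-- Values of the information `H_t^{-i}` of the players other than `i`. -/
abbrev OtherHist (i : I) (t : ℕ) : Type (max u v) := ∀ j : {j : I // j ≠ i}, G.Hist j t

variable {G}

/-- The probability of a path under a strategy profile: given the past, the players randomize
independently of each other according to their strategies, and nature's move is independent. -/
def pathProb (g : G.Profile) : ∀ t, t ≤ T → G.Path t → ℝ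
  | 0, _, ω => G.prior ω
  | t + 1, ht, ω =>
    pathProb g t (Nat.le_of_succ_le ht) ω.1 *
      (∏ i, g i ⟨t, ht⟩ (G.histOf i t ω.1) (ω.2.1 i)) * G.noise t ω.2.2

/-- The expectation `E^g[φ]`. -/
def expect (g : G.Profile) (φ : G.Outcome → ℝ) : ℝ :=
  ∑ ω : G.Outcome, pathProb g T le_rfl ω * φ ω

/-- The probability `Pr^g(A)`. -/
def prob (g : G.Profile) (A : Set G.Outcome) : ℝ := expect g (A.indicator 1)

/-- The conditional expectation `E^g[φ | A]` (used only if `Pr^g(A) > 0`). -/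
def condExpect (g : G.Profile) (φ : G.Outcome → ℝ) (A : Set G.Outcome) : ℝ :=
  expect g (A.indicator φ) / prob g A

/-- The conditional probability `Pr^g(B | A)` (used only if `Pr^g(A) > 0`). -/
def condProb (g : G.Profile) (B A : Set G.Outcome) : ℝ := prob g (B ∩ A) / prob g A

/-- The total payoff `J^i(g)`. -/
def payoff (g : G.Profile) (i : I) : ℝ := expect g fun ω => ∑ t : Fin T, G.rewardRV i t ω

variable (G) in
/-- `h` is a value that `H_t^i` can take, i.e. an information set of the game. -/
def Realizable (i : I) (t : Fin T) (h : G.Hist i t) : Prop :=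
  ∃ g : G.Profile, 0 < prob g {ω | G.histRV i t ω = h}

variable (G) in
/-- Collections of history-action value functions. -/
abbrev ValueFunctions : Type (max u v) := ∀ i : I, ∀ t : Fin T, G.Hist i t → G.U t i → ℝ

/-- Every action has positive probability at every information set. -/
def FullyMixed (g : G.Profile) : Prop :=
  ∀ (i : I) (t : Fin T) (h : G.Hist i t) (a : G.U t i), 0 < g i t h a

/-- `Q_τ^i(h, a)` is the conditional expectation under `g` of the rewards from time `τ` on,
given `H_τ^i = h` and `U_τ^i = a`, at every information set. -/
def Consistent (g : G.Profile) (Q : G.ValueFunctions) : Prop :=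
  ∀ (i : I) (τ : Fin T) (h : G.Hist i τ), G.Realizable i τ h → ∀ a : G.U τ i,
    Q i τ h a = condExpect g (fun ω => ∑ t ∈ Finset.Ici τ, G.rewardRV i t ω)
      {ω | G.histRV i τ ω = h ∧ G.actionRV τ ω i = a}

/-- At every information set only maximizers of `Q` are played. -/
def SequentiallyRational (g : G.Profile) (Q : G.ValueFunctions) : Prop :=
  ∀ (i : I) (t : Fin T) (h : G.Hist i t), G.Realizable i t h →
    ∀ a : G.U t i, 0 < g i t h a → ∀ b : G.U t i, Q i t h b ≤ Q i t h a

/-- `(g, Q)` is a limit of pairs of a fully mixed profile and a consistent collection. -/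
def FullyConsistent (g : G.Profile) (Q : G.ValueFunctions) : Prop :=
  ∃ (gs : ℕ → G.Profile) (Qs : ℕ → G.ValueFunctions),
    (∀ n, FullyMixed (gs n)) ∧ (∀ n, Consistent (gs n) (Qs n)) ∧
      Tendsto (fun n => (gs n, Qs n)) atTop (𝓝 (g, Q))

/-- `(g, Q)` is a sequential equilibrium. -/
def IsSequentialEquilibrium (g : G.Profile) (Q : G.ValueFunctions) : Prop :=
  SequentiallyRational g Q ∧ FullyConsistent g Q

variable (G) in
/-- A sequentially updated compression `K^i` of player `i`'s information: the spaces
`𝓚_t^i` with the update functions `ι_t^i`. -/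
structure Compression (i : I) where
  K : ℕ → Type u
  [finK : ∀ t, Fintype (K t)]
  init : G.H₁ i → K 0
  update : ∀ t, K t → G.Z t i → K (t + 1)

/-- The compressed information `K_t^i` as a function of `H_t^i`. -/
def Compression.compress {i : I} (κ : G.Compression i) : ∀ t, G.Hist i t → κ.K t
  | 0, h => κ.init h
  | t + 1, h => κ.update t (κ.compress t h.1) h.2

/-- The random variable `K_t^i`. -/
def Compression.rv {i : I} (κ : G.Compression i) (t : Fin T) (ω : G.Outcome) : κ.K t :=
  κ.compress t (G.histRV i t ω)

/-- `K^i` is unilaterally sufficient information for player `i`. -/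
def Compression.IsUSI {i : I} (κ : G.Compression i) : Prop :=
  ∃ (F : G.Strategy i → ∀ t : Fin T, κ.K t → stdSimplex ℝ (G.Hist i t))
    (Φ : G.OtherProfile i → ∀ t : Fin T, κ.K t → stdSimplex ℝ (G.X t × G.OtherHist i t)),
    ∀ (g : G.Profile) (t : Fin T) (k : κ.K t), 0 < prob g {ω | κ.rv t ω = k} →
      ∀ (x : G.X t) (h : ∀ j, G.Hist j t),
        condProb g {ω | G.stateRV t ω = x ∧ ∀ j, G.histRV j t ω = h j} {ω | κ.rv t ω = k} =
          F (g i) t k (h i) * Φ (fun j => g j) t k (x, fun j => h j)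

/-- The strategy `g^i` is induced by a `K^i`-based strategy `ρ^i`. -/
def Compression.IsBased {i : I} (κ : G.Compression i) (g : G.Strategy i) : Prop :=
  ∃ ρ : ∀ t : Fin T, κ.K t → stdSimplex ℝ (G.U t i),
    ∀ (t : Fin T) (h : G.Hist i t), g t h = ρ t (κ.compress t h)

variable (G) in
/-- The payoff profiles of all sequential equilibria. -/
def sePayoffs : Set (I → ℝ) :=
  {v | ∃ (g : G.Profile) (Q : G.ValueFunctions), IsSequentialEquilibrium g Q ∧ payoff g = v}

/-- The payoff profiles of all `K`-based sequential equilibria. Deviations to all strategies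
that depend on the full information are allowed. -/
def basedSEPayoffs (κ : ∀ i, G.Compression i) : Set (I → ℝ) :=
  {v | ∃ (g : G.Profile) (Q : G.ValueFunctions), (∀ i, (κ i).IsBased (g i)) ∧
    IsSequentialEquilibrium g Q ∧ payoff g = v}

end DynGame

end

namespace DynGame

variable {I : Type v} {T : ℕ} [Fintype I] [DecidableEq I] {G : DynGame.{u, v} I T}

/-! ### Expectations and moves of a single time -/

/-! Only the inclusion of all payoff profiles in the based ones needs work. Players are replaced one
at a time with `Q` fixed (`IsSequentialEquilibrium.exists_replace`). Let `gs n` be the fully mixed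
profiles approximating `g`. In `gs n`, replace player `i`'s strategy by its average ρₙ(a | k) = ∑ₕ
F(h | k) gₙ(a | h), which gives `hs n`.

Unilateral sufficiency makes `H_t^i` conditionally independent of (`X_t`, `H_t^{-i}`) given `K_t^i`.
An observer of `K_t^i`, `X_t` and `H_t^{-i}` therefore sees player `i` act according to ρₙ, and by
induction on time the joint law of these variables and the moves is the same under `gs n` and `hs n`
(`expect_replace_moves`). All payoffs and all conditional values of the other players are unchanged.

Player `i`'s own values may change for finite n, because the continuation strategy changes. But `Φ`
depends only on `k` and the opponents' strategies, so current rewards and observation probabilities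
given (h, a) agree under `gs n` and `hs n` and depend on h only through `k` (`condExpect_moves`).
Backward induction in the limit then applies (`actionValue_limit`): next-period values depend only
on `k`, the limit ρ of the averages charges only their maximizers (`support_argmax`), and so the old
and the new continuation both attain the maximum. The values under `hs n` thus converge to the same
`Q`.

`F` and `Φ` need not be continuous in the strategies, and conditioning events may become null in the
limit; compactness supplies a subsequence along which the averages, rewards and observation
probabilities converge. -/

lemma upTo_eq_fst (t : ℕ) (ht : t + 1 ≤ T) (ω : G.Outcome) :
    G.upTo t (Nat.le_of_succ_le ht) ω = (G.upTo (t + 1) ht ω).1 :=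
  Nat.decreasingInduction_succ_left _ _ ht _

lemma upTo_self (ω : G.Outcome) : G.upTo T le_rfl ω = ω :=
  Nat.decreasingInduction_self _ _

lemma upTo_succ (t : Fin T) (ω : G.Outcome) :
    G.upTo (t + 1) t.isLt ω = (G.upTo t t.isLt.le ω, G.actionRV t ω, G.noiseRV t ω) := by
  rw [upTo_eq_fst t t.isLt]; rfl

lemma stateRV_succ (t : ℕ) (ht : t + 1 < T) (ω : G.Outcome) :
    G.stateRV ⟨t + 1, ht⟩ ω = G.next t (G.stateRV ⟨t, Nat.lt_of_succ_lt ht⟩ ω)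
      (G.actionRV ⟨t, Nat.lt_of_succ_lt ht⟩ ω) (G.noiseRV ⟨t, Nat.lt_of_succ_lt ht⟩ ω) :=
  congrArg (G.stateOf (t + 1)) (upTo_succ ⟨t, Nat.lt_of_succ_lt ht⟩ ω)

lemma histRV_succ (i : I) (t : ℕ) (ht : t + 1 < T) (ω : G.Outcome) :
    G.histRV i ⟨t + 1, ht⟩ ω = (G.histRV i ⟨t, Nat.lt_of_succ_lt ht⟩ ω,
      G.obs t (G.stateRV ⟨t, Nat.lt_of_succ_lt ht⟩ ω)
      (G.actionRV ⟨t, Nat.lt_of_succ_lt ht⟩ ω) (G.noiseRV ⟨t, Nat.lt_of_succ_lt ht⟩ ω) i) :=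
  congrArg (G.histOf i (t + 1)) (upTo_succ ⟨t, Nat.lt_of_succ_lt ht⟩ ω)

lemma pathProb_nonneg (g : G.Profile) : ∀ t (ht : t ≤ T) (ω : G.Path t), 0 ≤ pathProb g t ht ω
  | 0, _, _ => stdSimplex.zero_le _ _
  | t + 1, _, _ => mul_nonneg (mul_nonneg (pathProb_nonneg g t _ _)
      (Finset.prod_nonneg fun _ _ => stdSimplex.zero_le _ _)) (stdSimplex.zero_le _ _)

lemma sum_pathProb_succ (g : G.Profile) (t : ℕ) (ht : t + 1 ≤ T) (φ : G.Path (t + 1) → ℝ) :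
    ∑ ω, pathProb g (t + 1) ht ω * φ ω = ∑ ω, pathProb g t (Nat.le_of_succ_le ht) ω *
      ∑ a : ∀ i, G.U t i, (∏ i, g i ⟨t, ht⟩ (G.histOf i t ω) (a i)) *
        ∑ w, G.noise t w * φ (ω, a, w) := by
  have : ∑ ω, pathProb g (t + 1) ht ω * φ ω = ∑ ω : G.Path t × (∀ i, G.U t i) × G.W t,
      pathProb g (t + 1) ht ω * φ ω := rfl
  rw [this, Fintype.sum_prod_type]
  refine Finset.sum_congr rfl fun ω _ => ?_
  rw [Fintype.sum_prod_type, Finset.mul_sum]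
  refine Finset.sum_congr rfl fun a _ => ?_
  rw [Finset.mul_sum, Finset.mul_sum]
  refine Finset.sum_congr rfl fun w _ => ?_
  simp only [pathProb]
  ring

lemma expect_upTo (g : G.Profile) (t : ℕ) (ht : t ≤ T) (φ : G.Path t → ℝ) :
    expect g (fun ω => φ (G.upTo t ht ω)) = ∑ ω, pathProb g t ht ω * φ ω := by
  revert φ
  refine Nat.decreasingInduction (motive := fun t ht => ∀ φ : G.Path t → ℝ,
    expect g (fun ω => φ (G.upTo t ht ω)) = ∑ ω, pathProb g t ht ω * φ ω) ?_ ?_ ht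
  · intro t ht ih φ
    have := ih fun ω => φ ω.1
    simp only [upTo_eq_fst t ht]
    rw [this, sum_pathProb_succ]
    refine Finset.sum_congr rfl fun ω _ => ?_
    simp only [← Finset.sum_mul]
    rw [← Fintype.prod_sum fun i a => g i ⟨t, ht⟩ (G.histOf i t ω) a]
    simp [stdSimplex.sum_eq_one]
  · intro φ
    simp only [upTo_self]
    rfl

/-- Given the past, the actions and the move of nature can be averaged out. -/
lemma expect_step (g : G.Profile) (t : Fin T)
    (φ : G.Path t → (∀ i, G.U t i) → G.W t → ℝ) :
    expect g (fun ω => φ (G.upTo t t.isLt.le ω) (G.actionRV t ω) (G.noiseRV t ω)) =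
      expect g (fun ω => ∑ a : ∀ i, G.U t i, (∏ i, g i t (G.histRV i t ω) (a i)) *
        ∑ w, G.noise t w * φ (G.upTo t t.isLt.le ω) a w) := by
  have h1 := expect_upTo g (t + 1) t.isLt fun ω => φ ω.1 ω.2.1 ω.2.2
  have h2 := expect_upTo g t t.isLt.le fun ω => ∑ a : ∀ i, G.U t i,
    (∏ i, g i t (G.histOf i t ω) (a i)) * ∑ w, G.noise t w * φ ω a w
  rw [sum_pathProb_succ] at h1
  simp only [upTo_succ] at h1
  exact h1.trans h2.symm

/-! ### Elementary properties of expectations -/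

lemma expect_sum {ι : Type*} (s : Finset ι) (g : G.Profile) (φ : ι → G.Outcome → ℝ) :
    expect g (fun ω => ∑ k ∈ s, φ k ω) = ∑ k ∈ s, expect g (φ k) := by
  simp only [expect, Finset.mul_sum]
  exact Finset.sum_comm

lemma expect_add (g : G.Profile) (φ ψ : G.Outcome → ℝ) :
    expect g (fun ω => φ ω + ψ ω) = expect g φ + expect g ψ := by
  simp only [expect, mul_add, Finset.sum_add_distrib]

lemma expect_mul_const (g : G.Profile) (φ : G.Outcome → ℝ) (c : ℝ) :
    expect g (fun ω => φ ω * c) = expect g φ * c := by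
  simp only [expect, Finset.sum_mul, mul_assoc]

lemma expect_mono (g : G.Profile) {φ ψ : G.Outcome → ℝ} (h : ∀ ω, φ ω ≤ ψ ω) :
    expect g φ ≤ expect g ψ :=
  Finset.sum_le_sum fun ω _ => mul_le_mul_of_nonneg_left (h ω) (pathProb_nonneg g T le_rfl ω)

lemma expect_nonneg (g : G.Profile) {φ : G.Outcome → ℝ} (h : ∀ ω, 0 ≤ φ ω) : 0 ≤ expect g φ :=
  Finset.sum_nonneg fun ω _ => mul_nonneg (pathProb_nonneg g T le_rfl ω) (h ω)

open Classical in
lemma prob_eq (g : G.Profile) (A : Set G.Outcome) :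
    prob g A = expect g (fun ω => if ω ∈ A then 1 else 0) := by
  simp only [prob]
  congr 1

lemma prob_setOf (g : G.Profile) (P : G.Outcome → Prop) [DecidablePred P] :
    prob g {ω | P ω} = expect g (fun ω => if P ω then 1 else 0) := by
  simp only [prob]
  congr 1 with ω
  simp [Set.indicator_apply]

lemma prob_nonneg (g : G.Profile) (A : Set G.Outcome) : 0 ≤ prob g A :=
  expect_nonneg g fun _ => Set.indicator_nonneg (fun _ _ => zero_le_one) _

lemma prob_mono (g : G.Profile) {A B : Set G.Outcome} (h : A ⊆ B) : prob g A ≤ prob g B :=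
  expect_mono g fun _ => Set.indicator_le_indicator_of_subset h (fun _ => zero_le_one) _

/-- Expectation of a function of a finite-valued random variable. -/
lemma expect_comp {β : Type*} [Fintype β] (g : G.Profile) (V : G.Outcome → β) (ψ : β → ℝ) :
    expect g (fun ω => ψ (V ω)) = ∑ b, prob g {ω | V ω = b} * ψ b := by
  classical
  simp only [prob_eq, ← expect_mul_const, ← expect_sum]
  simp

lemma abs_expect_indicator_le (g : G.Profile) (A : Set G.Outcome) {φ : G.Outcome → ℝ} {c : ℝ}
    (h : ∀ ω, |φ ω| ≤ c) : |expect g (A.indicator φ)| ≤ c * prob g A := by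
  classical
  rw [prob_eq, mul_comm, ← expect_mul_const, abs_le]
  have : -expect g (fun ω => (if ω ∈ A then 1 else 0) * c) =
      expect g (fun ω => (if ω ∈ A then 1 else 0) * -c) := by
    rw [expect_mul_const, expect_mul_const, mul_neg]
  rw [this]
  constructor <;> refine expect_mono g fun ω => ?_ <;> by_cases hω : ω ∈ A <;>
    simp [hω, (abs_le.1 (h ω)).1, (abs_le.1 (h ω)).2]

lemma abs_condExpect_le (g : G.Profile) (A : Set G.Outcome) {φ : G.Outcome → ℝ} {c : ℝ}
    (hc : 0 ≤ c) (h : ∀ ω, |φ ω| ≤ c) : |condExpect g φ A| ≤ c := by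
  rw [condExpect, abs_div, abs_of_nonneg (prob_nonneg g A)]
  exact div_le_of_le_mul₀ (prob_nonneg g A) hc (abs_expect_indicator_le g A h)

/-- For null events the bound on `φ` forces the left side to vanish, so no positivity is required.
-/
lemma expect_indicator_eq (g : G.Profile) (A : Set G.Outcome) {φ : G.Outcome → ℝ} {c : ℝ}
    (h : ∀ ω, |φ ω| ≤ c) : expect g (A.indicator φ) = prob g A * condExpect g φ A := by
  by_cases hA : prob g A = 0
  · have := abs_expect_indicator_le g A h
    rw [hA, mul_zero] at this
    rw [hA, zero_mul]
    exact abs_eq_zero.1 (le_antisymm this (abs_nonneg _))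
  · rw [condExpect, mul_div_cancel₀ _ hA]

/-! ### Positive probability under fully mixed profiles -/

lemma prob_pos_iff (g : G.Profile) (A : Set G.Outcome) :
    0 < prob g A ↔ ∃ ω ∈ A, 0 < pathProb g T le_rfl ω := by
  classical
  rw [prob_eq, expect]
  constructor
  · intro h
    obtain ⟨ω, -, hω⟩ := Finset.exists_lt_of_sum_lt (s := Finset.univ)
      (f := fun _ : G.Outcome => (0 : ℝ)) (by simpa using h)
    by_cases hA : ω ∈ A
    · exact ⟨ω, hA, by simpa [hA] using hω⟩
    · simp [hA] at hω
  · rintro ⟨ω, hA, hω⟩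
    refine Finset.sum_pos' (fun ω _ => mul_nonneg (pathProb_nonneg g T le_rfl ω) ?_)
      ⟨ω, Finset.mem_univ _, by simpa [hA] using hω⟩
    split_ifs <;> simp

/-- Under a fully mixed profile only the prior and nature can exclude a path, and these are common
to all profiles. -/
lemma FullyMixed.pathProb_pos {g : G.Profile} (hg : FullyMixed g) (g' : G.Profile) :
    ∀ t (ht : t ≤ T) (ω : G.Path t), 0 < pathProb g' t ht ω → 0 < pathProb g t ht ω
  | 0, _, _, h => h
  | t + 1, ht, ω, h => by
    have h0 := pathProb_nonneg g' t (Nat.le_of_succ_le ht) ω.1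
    have hn : 0 ≤ G.noise t ω.2.2 := stdSimplex.zero_le _ _
    simp only [pathProb] at h ⊢
    have h1 : 0 < pathProb g' t (Nat.le_of_succ_le ht) ω.1 :=
      lt_of_le_of_ne h0 fun h' => by simp [← h'] at h
    have h2 : 0 < G.noise t ω.2.2 := lt_of_le_of_ne hn fun h' => by simp [← h'] at h
    exact mul_pos (mul_pos (hg.pathProb_pos g' t _ _ h1)
      (Finset.prod_pos fun i _ => hg i ⟨t, ht⟩ _ _)) h2

lemma FullyMixed.prob_pos {g : G.Profile} (hg : FullyMixed g) {i : I} {t : Fin T}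
    {h : G.Hist i t} (hh : G.Realizable i t h) : 0 < prob g {ω | G.histRV i t ω = h} := by
  obtain ⟨g', hg'⟩ := hh
  obtain ⟨ω, hA, hω⟩ := (prob_pos_iff _ _).1 hg'
  exact (prob_pos_iff _ _).2 ⟨ω, hA, hg.pathProb_pos g' _ _ _ hω⟩

/-! ### Conditioning on an action -/

open Classical in
-- Absorbing the indicator into factor `i` keeps the product form, so the sum factorizes over the
-- players.
lemma sum_prod_ite (t : ℕ) (i : I) (a : G.U t i) (f : ∀ j, G.U t j → ℝ)
    (hf : ∀ j, ∑ b, f j b = 1) :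
    ∑ b : ∀ j, G.U t j, (∏ j, f j (b j)) * (if b i = a then 1 else 0) = f i a := by
  have h1 : ∀ b : ∀ j, G.U t j, (∏ j, f j (b j)) * (if b i = a then 1 else 0) =
      ∏ j, Function.update f i (fun c => if c = a then f i c else 0) j (b j) := by
    intro b
    rw [Fintype.prod_eq_mul_prod_subtype_ne (fun j => f j (b j)) i,
      Fintype.prod_eq_mul_prod_subtype_ne _ i]
    have : ∀ j : {j // j ≠ i}, Function.update f i (fun c => if c = a then f i c else 0) j (b j) =
        f j (b j) := fun j => by rw [Function.update_of_ne j.2]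
    simp only [this, Function.update_self]
    split_ifs <;> ring
  simp only [h1]
  rw [← Fintype.prod_sum, Fintype.prod_eq_mul_prod_subtype_ne _ i]
  have : ∀ j : {j // j ≠ i}, ∑ b, Function.update f i (fun c => if c = a then f i c else 0) j b =
      1 := fun j => by rw [Function.update_of_ne j.2]; exact hf j
  simp [this]

lemma prob_hist_action (g : G.Profile) (i : I) (t : Fin T) (h : G.Hist i t) (a : G.U t i) :
    prob g {ω | G.histRV i t ω = h ∧ G.actionRV t ω i = a} =
      prob g {ω | G.histRV i t ω = h} * g i t h a := by
  classical
  rw [prob_setOf, prob_setOf, ← expect_mul_const]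
  have := expect_step g t fun p b _ => if G.histOf i t p = h ∧ b i = a then 1 else 0
  refine Eq.trans this (congrArg (expect g) (funext fun ω => ?_))
  simp only [← Finset.sum_mul, stdSimplex.sum_eq_one, one_mul]
  by_cases hω : G.histRV i t ω = h
  · have hω' : G.histOf i t (G.upTo t t.isLt.le ω) = h := hω
    have := sum_prod_ite t i a (fun j => g j t (G.histRV j t ω)) fun j => stdSimplex.sum_eq_one _
    simp only [hω', true_and, hω, if_true, one_mul]
    rw [this, hω]
  · have hω' : G.histOf i t (G.upTo t t.isLt.le ω) ≠ h := hω
    simp [hω, hω']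

attribute [local instance] Compression.finK

/-! ### Factorization of the conditional law given the compressed information -/

/-- The random vector `H_t^{-i}`. -/
def otherHistRV (i : I) (t : Fin T) (ω : G.Outcome) : G.OtherHist i t :=
  fun j => G.histRV j t ω

lemma otherHistRV_succ (i : I) (t : ℕ) (ht : t + 1 < T) (ω : G.Outcome) :
    otherHistRV i ⟨t + 1, ht⟩ ω = fun j => (otherHistRV i ⟨t, Nat.lt_of_succ_lt ht⟩ ω j,
      G.obs t (G.stateRV ⟨t, Nat.lt_of_succ_lt ht⟩ ω)
      (G.actionRV ⟨t, Nat.lt_of_succ_lt ht⟩ ω) (G.noiseRV ⟨t, Nat.lt_of_succ_lt ht⟩ ω) j) :=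
  funext fun j => histRV_succ (G := G) j t ht ω

lemma Compression.rv_succ {i : I} (κ : G.Compression i) (t : ℕ) (ht : t + 1 < T)
    (ω : G.Outcome) :
    κ.rv ⟨t + 1, ht⟩ ω = κ.update t (κ.rv ⟨t, Nat.lt_of_succ_lt ht⟩ ω)
      (G.obs t (G.stateRV ⟨t, Nat.lt_of_succ_lt ht⟩ ω)
      (G.actionRV ⟨t, Nat.lt_of_succ_lt ht⟩ ω) (G.noiseRV ⟨t, Nat.lt_of_succ_lt ht⟩ ω) i) := by
  rw [Compression.rv, histRV_succ]
  rfl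

/-- The functions `F` and `Φ` witness that `κ` is unilaterally sufficient information. -/
def Compression.FactorsAs {i : I} (κ : G.Compression i)
    (F : G.Strategy i → ∀ t : Fin T, κ.K t → stdSimplex ℝ (G.Hist i t))
    (Φ : G.OtherProfile i → ∀ t : Fin T, κ.K t → stdSimplex ℝ (G.X t × G.OtherHist i t)) : Prop :=
  ∀ (g : G.Profile) (t : Fin T) (k : κ.K t), 0 < prob g {ω | κ.rv t ω = k} →
    ∀ (x : G.X t) (h : ∀ j, G.Hist j t),
      condProb g {ω | G.stateRV t ω = x ∧ ∀ j, G.histRV j t ω = h j} {ω | κ.rv t ω = k} =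
        F (g i) t k (h i) * Φ (fun j => g j) t k (x, fun j => h j)

section

variable {i : I} {κ : G.Compression i}
  {F : G.Strategy i → ∀ t : Fin T, κ.K t → stdSimplex ℝ (G.Hist i t)}
  {Φ : G.OtherProfile i → ∀ t : Fin T, κ.K t → stdSimplex ℝ (G.X t × G.OtherHist i t)}

/-- Given `k`, player `i`'s information and the pair of state and others' information are
independent with laws `F` and `Φ`. The arbitrary values of `F` and `Φ` at null `k` carry weight
zero. -/
lemma Compression.FactorsAs.expect_eq (hκ : κ.FactorsAs F Φ) (g : G.Profile) (t : Fin T)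
    (ψ : κ.K t → G.X t → G.Hist i t → G.OtherHist i t → ℝ) :
    expect g (fun ω => ψ (κ.rv t ω) (G.stateRV t ω) (G.histRV i t ω) (otherHistRV i t ω)) =
      ∑ k, prob g {ω | κ.rv t ω = k} * ∑ y, Φ (fun j => g j) t k y *
        ∑ h, F (g i) t k h * ψ k y.1 h y.2 := by
  have h1 := expect_comp g (fun ω => (κ.rv t ω, G.stateRV t ω, fun j => G.histRV j t ω))
    fun b : κ.K t × G.X t × (∀ j, G.Hist j t) => ψ b.1 b.2.1 (b.2.2 i) fun j => b.2.2 j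
  refine Eq.trans h1 ?_
  rw [Fintype.sum_prod_type]
  refine Finset.sum_congr rfl fun k _ => ?_
  rw [Fintype.sum_prod_type, Fintype.sum_prod_type, Finset.mul_sum]
  refine Finset.sum_congr rfl fun x _ => ?_
  have h2 : ∀ h : ∀ j, G.Hist j t,
      prob g {ω | (κ.rv t ω, G.stateRV t ω, fun j => G.histRV j t ω) = (k, x, h)} =
      prob g {ω | κ.rv t ω = k} * (F (g i) t k (h i) * Φ (fun j => g j) t k (x, fun j => h j)) := by
    intro h
    have hs : {ω | (κ.rv t ω, G.stateRV t ω, fun j => G.histRV j t ω) = (k, x, h)} =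
        {ω | G.stateRV t ω = x ∧ ∀ j, G.histRV j t ω = h j} ∩ {ω | κ.rv t ω = k} := by
      ext ω
      simp only [Prod.mk.injEq, funext_iff, Set.mem_inter_iff, Set.mem_ofPred_eq]
      tauto
    rw [hs]
    rcases (prob_nonneg g {ω | κ.rv t ω = k}).eq_or_lt with h0 | h0
    · rw [← h0, zero_mul]
      exact le_antisymm (h0 ▸ prob_mono g Set.inter_subset_right) (prob_nonneg _ _)
    · rw [← hκ g t k h0 x h, condProb, mul_div_cancel₀ _ h0.ne']
  simp only [h2]
  refine (Fintype.sum_equiv (Equiv.piSplitAt i fun j => G.Hist j t) _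
    (fun b => prob g {ω | κ.rv t ω = k} * (F (g i) t k b.1 * Φ (fun j => g j) t k (x, b.2)) *
      ψ k x b.1 b.2) (fun _ => rfl)).trans ?_
  rw [Fintype.sum_prod_type, Finset.sum_comm, Finset.mul_sum]
  refine Finset.sum_congr rfl fun y _ => ?_
  simp only [Finset.mul_sum]
  exact Finset.sum_congr rfl fun h _ => by ring

lemma Compression.FactorsAs.expect_eq' (hκ : κ.FactorsAs F Φ) (g : G.Profile) (t : Fin T)
    (ψ : κ.K t → G.X t → G.OtherHist i t → ℝ) :
    expect g (fun ω => ψ (κ.rv t ω) (G.stateRV t ω) (otherHistRV i t ω)) =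
      ∑ k, prob g {ω | κ.rv t ω = k} * ∑ y, Φ (fun j => g j) t k y * ψ k y.1 y.2 := by
  rw [hκ.expect_eq g t fun k x _ => ψ k x]
  simp only [← Finset.sum_mul, stdSimplex.sum_eq_one, one_mul]

/-! ### The compressed strategy -/

/-- The compressed strategy: conditionally on `K_t^i = k`, play as `g` does on average. -/
def averageStrategy (F : ∀ t : Fin T, κ.K t → stdSimplex ℝ (G.Hist i t)) (g : G.Strategy i)
    (t : Fin T) (k : κ.K t) : stdSimplex ℝ (G.U t i) :=
  ⟨fun a => ∑ h, F t k h * g t h a,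
    fun _ => Finset.sum_nonneg fun _ _ => mul_nonneg (stdSimplex.zero_le _ _)
      (stdSimplex.zero_le _ _), by
    rw [Finset.sum_comm]
    simp only [← Finset.mul_sum, stdSimplex.sum_eq_one, mul_one]⟩

lemma averageStrategy_apply (F : ∀ t : Fin T, κ.K t → stdSimplex ℝ (G.Hist i t))
    (g : G.Strategy i) (t : Fin T) (k : κ.K t) (a : G.U t i) :
    averageStrategy F g t k a = ∑ h, F t k h * g t h a := rfl

/-- The behavioral strategy induced by a strategy that uses the compressed information. -/
def Compression.lift (κ : G.Compression i) (ρ : ∀ t : Fin T, κ.K t → stdSimplex ℝ (G.U t i)) :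
    G.Strategy i := fun t h => ρ t (κ.compress t h)

lemma averageStrategy_pos (F : ∀ t : Fin T, κ.K t → stdSimplex ℝ (G.Hist i t))
    {g : G.Strategy i} (hg : ∀ t h a, 0 < g t h a) (t : Fin T) (k : κ.K t) (a : G.U t i) :
    0 < averageStrategy F g t k a := by
  rw [averageStrategy_apply]
  obtain ⟨h, -, hh⟩ := Finset.exists_lt_of_sum_lt (s := Finset.univ)
    (f := fun _ : G.Hist i t => (0 : ℝ)) (g := fun h => F t k h)
    (by simp [stdSimplex.sum_eq_one])
  exact Finset.sum_pos' (fun h _ => mul_nonneg (stdSimplex.zero_le _ _) (hg t h a).le)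
    ⟨h, Finset.mem_univ _, mul_pos hh (hg t h a)⟩

/-- Factor out the choice of player `i` when averaging over the moves of one time. -/
lemma expect_step_split (g : G.Profile) (i : I) (t : Fin T)
    (φ : G.X t → G.Hist i t → G.OtherHist i t → (∀ j, G.U t j) → G.W t → ℝ) :
    expect g (fun ω => φ (G.stateRV t ω) (G.histRV i t ω) (otherHistRV i t ω)
        (G.actionRV t ω) (G.noiseRV t ω)) =
      expect g (fun ω => ∑ a : ∀ j, G.U t j, g i t (G.histRV i t ω) (a i) *
        ((∏ j : {j // j ≠ i}, g j t (otherHistRV i t ω j) (a j)) *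
        ∑ w, G.noise t w * φ (G.stateRV t ω) (G.histRV i t ω) (otherHistRV i t ω) a w)) := by
  refine (expect_step g t fun p a w => φ (G.stateOf t p) (G.histOf i t p)
    (fun j => G.histOf j t p) a w).trans (congrArg _ (funext fun ω =>
      Finset.sum_congr rfl fun a _ => ?_))
  rw [Fintype.prod_eq_mul_prod_subtype_ne _ i, mul_assoc]
  rfl

/-- Integrating out `H_t^i` against `F` turns the choice probability of player `i` into the averaged
one; `ih` then carries the result to the new profile. The factorization is applied under `g` only.
-/
lemma Compression.FactorsAs.expect_replace_step (hκ : κ.FactorsAs F Φ) (g : G.Profile) (t : Fin T)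
    (ih : ∀ ψ : κ.K t → G.X t → G.OtherHist i t → ℝ,
      expect g (fun ω => ψ (κ.rv t ω) (G.stateRV t ω) (otherHistRV i t ω)) =
      expect (Function.update g i (κ.lift (averageStrategy (F (g i)) (g i))))
        (fun ω => ψ (κ.rv t ω) (G.stateRV t ω) (otherHistRV i t ω)))
    (φ : κ.K t → G.X t → G.OtherHist i t → (∀ j, G.U t j) → G.W t → ℝ) :
    expect g (fun ω => φ (κ.rv t ω) (G.stateRV t ω) (otherHistRV i t ω)
        (G.actionRV t ω) (G.noiseRV t ω)) =
      expect (Function.update g i (κ.lift (averageStrategy (F (g i)) (g i))))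
        (fun ω => φ (κ.rv t ω) (G.stateRV t ω) (otherHistRV i t ω)
        (G.actionRV t ω) (G.noiseRV t ω)) := by
  set A : κ.K t → G.X t → G.OtherHist i t → (∀ j, G.U t j) → ℝ := fun k x h a =>
    (∏ j : {j // j ≠ i}, g j t (h j) (a j)) * ∑ w, G.noise t w * φ k x h a w with hA
  have h1 := expect_step_split g i t fun x h h' a w => φ (κ.compress t h) x h' a w
  have h2 := expect_step_split (Function.update g i (κ.lift (averageStrategy (F (g i)) (g i))))
    i t fun x h h' a w => φ (κ.compress t h) x h' a w
  have h3 := hκ.expect_eq g t fun k x h h' => ∑ a : ∀ j, G.U t j, g i t h (a i) * A k x h' a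
  have h4 := hκ.expect_eq' g t fun k x h' =>
    ∑ a : ∀ j, G.U t j, averageStrategy (F (g i)) (g i) t k (a i) * A k x h' a
  have h5 := ih fun k x h' =>
    ∑ a : ∀ j, G.U t j, averageStrategy (F (g i)) (g i) t k (a i) * A k x h' a
  refine (h1.trans h3).trans (Eq.trans ?_ ((h4.symm.trans h5).trans (Eq.trans ?_ h2.symm)))
  · refine Finset.sum_congr rfl fun k _ => congrArg _ (Finset.sum_congr rfl fun y _ =>
      congrArg _ ?_)
    simp only [Finset.mul_sum (s := (Finset.univ : Finset (∀ j, G.U t j)))]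
    rw [Finset.sum_comm]
    refine Finset.sum_congr rfl fun a _ => ?_
    rw [averageStrategy_apply, Finset.sum_mul]
    exact Finset.sum_congr rfl fun h _ => by ring
  · refine congrArg _ (funext fun ω => Finset.sum_congr rfl fun a _ => ?_)
    have hu : ∀ j : {j // j ≠ i},
        Function.update g i (κ.lift (averageStrategy (F (g i)) (g i))) j = g j :=
      fun j => Function.update_of_ne j.2 _ _
    simp only [hu, Function.update_self]
    rfl

lemma Compression.FactorsAs.expect_replace (hκ : κ.FactorsAs F Φ) (g : G.Profile) (t : ℕ) (ht : t < T)
    (ψ : κ.K t → G.X t → G.OtherHist i t → ℝ) :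
    expect g (fun ω => ψ (κ.rv ⟨t, ht⟩ ω) (G.stateRV ⟨t, ht⟩ ω) (otherHistRV i ⟨t, ht⟩ ω)) =
      expect (Function.update g i (κ.lift (averageStrategy (F (g i)) (g i))))
        (fun ω => ψ (κ.rv ⟨t, ht⟩ ω) (G.stateRV ⟨t, ht⟩ ω) (otherHistRV i ⟨t, ht⟩ ω)) := by
  induction t with
  | zero =>
    -- At time 0 the law is the prior, which involves no strategy.
    have h : ∀ g : G.Profile, _ := fun g => expect_upTo g 0 ht.le fun p =>
      ψ (κ.compress 0 (G.histOf i 0 p)) (G.stateOf 0 p) fun j => G.histOf j 0 p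
    exact (h g).trans (Eq.trans rfl
      (h (Function.update g i (κ.lift (averageStrategy (F (g i)) (g i))))).symm)
  | succ t ih =>
    have := hκ.expect_replace_step g ⟨t, Nat.lt_of_succ_lt ht⟩ (ih _) fun k x h a w =>
      ψ (κ.update t k (G.obs t x a w i)) (G.next t x a w) fun j => (h j, G.obs t x a w j)
    simp only [Compression.rv_succ, otherHistRV_succ, stateRV_succ]
    exact this

/-- Replacing the strategy of player `i` by the compressed strategy does not change the joint law
of the compressed information, the state, the others' information and the moves. -/
lemma Compression.FactorsAs.expect_replace_moves (hκ : κ.FactorsAs F Φ) (g : G.Profile) (t : Fin T)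
    (φ : κ.K t → G.X t → G.OtherHist i t → (∀ j, G.U t j) → G.W t → ℝ) :
    expect g (fun ω => φ (κ.rv t ω) (G.stateRV t ω) (otherHistRV i t ω)
        (G.actionRV t ω) (G.noiseRV t ω)) =
      expect (Function.update g i (κ.lift (averageStrategy (F (g i)) (g i))))
        (fun ω => φ (κ.rv t ω) (G.stateRV t ω) (otherHistRV i t ω)
        (G.actionRV t ω) (G.noiseRV t ω)) :=
  hκ.expect_replace_step g t (hκ.expect_replace g t t.isLt) φ

end

/-- Perfect recall: past information and past actions are functions of later information. -/
lemma exists_recall (j : I) (s : Fin T) (h : G.Hist j s) (a : G.U s j) (t : ℕ) (hst : s < t)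
    (ht : t < T) : ∃ f : G.Hist j t → Prop, ∀ ω,
      (G.histRV j s ω = h ∧ G.actionRV s ω j = a) ↔ f (G.histRV j ⟨t, ht⟩ ω) := by
  induction t, hst using Nat.le_induction with
  | base =>
    obtain ⟨act, hact⟩ := G.own_action s j
    refine ⟨fun h' => h'.1 = h ∧ act h'.2 = a, fun ω => ?_⟩
    simp only [histRV_succ j s ht, hact]
  | succ t _ ih =>
    obtain ⟨f, hf⟩ := ih (Nat.lt_of_succ_lt ht)
    refine ⟨fun h' => f h'.1, fun ω => ?_⟩
    rw [hf, histRV_succ j t ht]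

lemma abs_rewardRV_le (i : I) (t : Fin T) (ω : G.Outcome) : |G.rewardRV i t ω| ≤ 1 :=
  abs_le.2 (G.reward_mem _ _ _ _ _)

lemma abs_sum_rewardRV_le (i : I) (s : Finset (Fin T)) (ω : G.Outcome) :
    |∑ t ∈ s, G.rewardRV i t ω| ≤ s.card :=
  (Finset.abs_sum_le_sum_abs _ _).trans
    ((Finset.sum_le_card_nsmul _ _ 1 fun t _ => abs_rewardRV_le i t ω).trans (by simp))

section

variable {i : I} {κ : G.Compression i}
  {F : G.Strategy i → ∀ t : Fin T, κ.K t → stdSimplex ℝ (G.Hist i t)}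
  {Φ : G.OtherProfile i → ∀ t : Fin T, κ.K t → stdSimplex ℝ (G.X t × G.OtherHist i t)}

/-! ### The replacement does not affect payoffs and the other players' values -/

lemma Compression.FactorsAs.payoff_replace (hκ : κ.FactorsAs F Φ) (g : G.Profile) (j : I) :
    payoff (Function.update g i (κ.lift (averageStrategy (F (g i)) (g i)))) j = payoff g j := by
  simp only [payoff]
  rw [expect_sum, expect_sum]
  exact Finset.sum_congr rfl fun t _ =>
    (hκ.expect_replace_moves g t fun _ x _ a w => G.reward t x a w j).symm

/-- By perfect recall, the conditioning event is visible in `H_t^{-i}` at every later time t, and at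
time `s` in `H_s^{-i}` and the actions. Numerator and denominator are thus covered by
`expect_replace_moves`. -/
lemma Compression.FactorsAs.condExpect_replace (hκ : κ.FactorsAs F Φ) (g : G.Profile) {j : I}
    (hj : j ≠ i) (s : Fin T) (h : G.Hist j s) (a : G.U s j) :
    condExpect (Function.update g i (κ.lift (averageStrategy (F (g i)) (g i))))
        (fun ω => ∑ t ∈ Finset.Ici s, G.rewardRV j t ω)
        {ω | G.histRV j s ω = h ∧ G.actionRV s ω j = a} =
      condExpect g (fun ω => ∑ t ∈ Finset.Ici s, G.rewardRV j t ω)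
        {ω | G.histRV j s ω = h ∧ G.actionRV s ω j = a} := by
  classical
  have key : ∀ t : Fin T, s ≤ t → ∀ ρ : G.X t → (∀ j, G.U t j) → G.W t → ℝ,
      expect (Function.update g i (κ.lift (averageStrategy (F (g i)) (g i)))) (fun ω =>
        if G.histRV j s ω = h ∧ G.actionRV s ω j = a then
          ρ (G.stateRV t ω) (G.actionRV t ω) (G.noiseRV t ω) else 0) =
      expect g (fun ω => if G.histRV j s ω = h ∧ G.actionRV s ω j = a then
          ρ (G.stateRV t ω) (G.actionRV t ω) (G.noiseRV t ω) else 0) := by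
    intro t hst ρ
    rcases hst.eq_or_lt with rfl | hst
    · exact (hκ.expect_replace_moves g s fun _ x h' b w =>
        if h' ⟨j, hj⟩ = h ∧ b j = a then ρ x b w else 0).symm
    · obtain ⟨f, hf⟩ := exists_recall j s h a t hst t.isLt
      simp only [hf]
      exact (hκ.expect_replace_moves g t fun _ x h' b w =>
        if f (h' ⟨j, hj⟩) then ρ x b w else 0).symm
  have hind : ∀ ω, ({ω | G.histRV j s ω = h ∧ G.actionRV s ω j = a} : Set G.Outcome).indicator
      (fun ω => ∑ t ∈ Finset.Ici s, G.rewardRV j t ω) ω = ∑ t ∈ Finset.Ici s,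
        if G.histRV j s ω = h ∧ G.actionRV s ω j = a then G.rewardRV j t ω else 0 := by
    intro ω
    simp only [Set.indicator_apply, Set.mem_ofPred_eq]
    split_ifs <;> simp
  simp only [condExpect, prob_setOf]
  congr 1
  · rw [funext hind, expect_sum, expect_sum]
    exact Finset.sum_congr rfl fun t ht => key t (Finset.mem_Ici.1 ht)
      fun x a w => G.reward t x a w j
  · exact key s le_rfl fun _ _ _ => 1

/-! ### The decision problem of player `i` -/

open Classical in
/-- The expectation of a function of the state, the actions and the move of nature, when player
`i` has the compressed information `k` and plays `a`. -/
noncomputable def localExpect (g : G.OtherProfile i) (t : Fin T)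
    (μ : stdSimplex ℝ (G.X t × G.OtherHist i t)) (a : G.U t i)
    (ψ : G.X t → (∀ j, G.U t j) → G.W t → ℝ) : ℝ :=
  ∑ y, μ y * ∑ b : ∀ j, G.U t j, if b i = a then
    (∏ j : {j // j ≠ i}, g j t (y.2 j) (b j)) * ∑ w, G.noise t w * ψ y.1 b w else 0

lemma Compression.FactorsAs.prob_hist (hκ : κ.FactorsAs F Φ) (g : G.Profile) (t : Fin T)
    (h : G.Hist i t) : prob g {ω | G.histRV i t ω = h} =
      prob g {ω | κ.rv t ω = κ.compress t h} * F (g i) t (κ.compress t h) h := by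
  classical
  have h1 := hκ.expect_eq g t fun k _ h' _ => if k = κ.compress t h ∧ h' = h then 1 else 0
  have h2 : ∀ ω, (κ.rv t ω = κ.compress t h ∧ G.histRV i t ω = h) ↔ G.histRV i t ω = h :=
    fun ω => ⟨And.right, fun h' => ⟨congrArg (κ.compress t) h', h'⟩⟩
  simp only [h2] at h1
  rw [prob_setOf, h1]
  simp only [← Finset.sum_mul, stdSimplex.sum_eq_one, one_mul]
  rw [Finset.sum_eq_single (κ.compress t h)] <;> simp +contextual

/-- The joint probability of `k` and `h` is Pr(k) F(h | k) > 0, so some path realizes both. -/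
lemma Compression.FactorsAs.compress_eq (hκ : κ.FactorsAs F Φ) (g : G.Profile) (t : Fin T)
    (k : κ.K t) (hk : 0 < prob g {ω | κ.rv t ω = k}) (h : G.Hist i t)
    (hF : 0 < F (g i) t k h) : κ.compress t h = k ∧ G.Realizable i t h := by
  classical
  have h1 := hκ.expect_eq g t fun k' _ h' _ => if k' = k ∧ h' = h then 1 else 0
  simp only [← Finset.sum_mul, stdSimplex.sum_eq_one, one_mul] at h1
  rw [Finset.sum_eq_single k (by simp +contextual) (by simp), ← prob_setOf] at h1
  simp only [true_and, mul_ite, mul_one, mul_zero, Finset.sum_ite_eq', Finset.mem_univ,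
    if_true] at h1
  have h2 := h1 ▸ mul_pos hk hF
  refine ⟨?_, g, h2.trans_le (prob_mono g fun ω hω => hω.2)⟩
  obtain ⟨ω, ⟨h3, h4⟩, -⟩ := (prob_pos_iff _ _).1 h2
  rw [← h3, ← h4]
  rfl

/-- Player `i`'s own strategy enters only through the prefactor, which is the probability of the
event; it cancels on conditioning. -/
lemma Compression.FactorsAs.expect_hist_action (hκ : κ.FactorsAs F Φ) (g : G.Profile)
    (t : Fin T) (h : G.Hist i t) (a : G.U t i) (ψ : G.X t → (∀ j, G.U t j) → G.W t → ℝ) :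
    expect g (({ω | G.histRV i t ω = h ∧ G.actionRV t ω i = a} : Set G.Outcome).indicator
        fun ω => ψ (G.stateRV t ω) (G.actionRV t ω) (G.noiseRV t ω)) =
      prob g {ω | G.histRV i t ω = h} * g i t h a *
        localExpect (fun j => g j) t (Φ (fun j => g j) t (κ.compress t h)) a ψ := by
  classical
  have h1 := expect_step_split g i t fun x h' _ b w =>
    if h' = h ∧ b i = a then ψ x b w else 0
  have h2 := hκ.expect_eq g t fun k x h' h'' => if k = κ.compress t h ∧ h' = h then
    ∑ b : ∀ j, G.U t j, g i t h (b i) * (if b i = a then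
      (∏ j : {j // j ≠ i}, g j t (h'' j) (b j)) * ∑ w, G.noise t w * ψ x b w else 0) else 0
  have h3 : ({ω | G.histRV i t ω = h ∧ G.actionRV t ω i = a} : Set G.Outcome).indicator
      (fun ω => ψ (G.stateRV t ω) (G.actionRV t ω) (G.noiseRV t ω)) = fun ω =>
        if G.histRV i t ω = h ∧ G.actionRV t ω i = a then
          ψ (G.stateRV t ω) (G.actionRV t ω) (G.noiseRV t ω) else 0 := by
    ext ω
    simp [Set.indicator_apply]
  rw [h3, h1]
  have h4 : ∀ ω, (κ.rv t ω = κ.compress t h ∧ G.histRV i t ω = h) ↔ G.histRV i t ω = h :=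
    fun ω => ⟨And.right, fun h' => ⟨congrArg (κ.compress t) h', h'⟩⟩
  simp only [h4] at h2
  refine Eq.trans (congrArg _ (funext fun ω => ?_)) (h2.trans ?_)
  · by_cases hω : G.histRV i t ω = h
    · simp only [hω, true_and, if_true]
      refine Finset.sum_congr rfl fun b _ => ?_
      by_cases hb : b i = a <;> simp [hb]
    · simp [hω]
  · rw [Finset.sum_eq_single (κ.compress t h) (by simp +contextual) (by simp), hκ.prob_hist,
      localExpect]
    simp only [true_and, mul_ite, mul_zero, Finset.sum_ite_eq', Finset.mem_univ, if_true]
    rw [mul_assoc, mul_assoc, Finset.mul_sum _ _ (g i t h a), Finset.mul_sum _ _ (F _ _ _ _)]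
    refine congrArg _ (Finset.sum_congr rfl fun y _ => ?_)
    have h5 : ∀ b : ∀ j, G.U t j, (if b i = a then g i t h (b i) *
        ((∏ j : {j // j ≠ i}, g j t (y.2 j) (b j)) * ∑ w, G.noise t w * ψ y.1 b w) else 0) =
        g i t h a * if b i = a then
          (∏ j : {j // j ≠ i}, g j t (y.2 j) (b j)) * ∑ w, G.noise t w * ψ y.1 b w else 0 := by
      intro b
      split_ifs with hb
      · rw [hb]
      · simp
    simp only [h5, ← Finset.mul_sum]
    ring

/-- Given the information and the action of player `i`, the conditional law of the state, the
actions and the move of nature depends only on the compressed information. -/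
lemma Compression.FactorsAs.condExpect_moves (hκ : κ.FactorsAs F Φ) {g : G.Profile}
    (hg : FullyMixed g) (t : Fin T) {h : G.Hist i t} (hh : G.Realizable i t h) (a : G.U t i)
    (ψ : G.X t → (∀ j, G.U t j) → G.W t → ℝ) :
    condExpect g (fun ω => ψ (G.stateRV t ω) (G.actionRV t ω) (G.noiseRV t ω))
        {ω | G.histRV i t ω = h ∧ G.actionRV t ω i = a} =
      localExpect (fun j => g j) t (Φ (fun j => g j) t (κ.compress t h)) a ψ := by
  rw [condExpect, hκ.expect_hist_action, prob_hist_action, mul_div_cancel_left₀]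
  exact (mul_pos (hg.prob_pos hh) (hg i t h a)).ne'

/-! ### ### Bellman equation for the action values -/

/-- The conditional expectation of the current reward of player `i`. -/
noncomputable def stageReward (g : G.Profile) (i : I) (t : Fin T) (h : G.Hist i t) (a : G.U t i) : ℝ :=
  condExpect g (fun ω => G.rewardRV i t ω) {ω | G.histRV i t ω = h ∧ G.actionRV t ω i = a}

open Classical in
/-- The conditional probability of the new information of player `i`. -/
noncomputable def obsProb (g : G.Profile) (i : I) (t : Fin T) (h : G.Hist i t) (a : G.U t i)
    (z : G.Z t i) : ℝ :=
  condExpect g (fun ω => if G.obs t (G.stateRV t ω) (G.actionRV t ω) (G.noiseRV t ω) i = z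
    then 1 else 0) {ω | G.histRV i t ω = h ∧ G.actionRV t ω i = a}

/-- The conditional expectation of the future rewards of player `i`. -/
noncomputable def actionValue (g : G.Profile) (i : I) (t : Fin T) (h : G.Hist i t) (a : G.U t i) : ℝ :=
  condExpect g (fun ω => ∑ s ∈ Finset.Ici t, G.rewardRV i s ω)
    {ω | G.histRV i t ω = h ∧ G.actionRV t ω i = a}

/-- The value of a history before the action is chosen. -/
noncomputable def histValue (s : G.Strategy i) (Q : ∀ t : Fin T, G.Hist i t → G.U t i → ℝ) (t : ℕ)
    (h : G.Hist i t) : ℝ :=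
  if ht : t < T then ∑ a, s ⟨t, ht⟩ h a * Q ⟨t, ht⟩ h a else 0

/-- The tower property, tested against `f` so that histories of probability zero need no separate
treatment. -/
lemma expect_hist_mul_future (g : G.Profile) (i : I) (t : Fin T) (f : G.Hist i t → ℝ) :
    expect g (fun ω => f (G.histRV i t ω) * ∑ s ∈ Finset.Ici t, G.rewardRV i s ω) =
      expect g (fun ω => f (G.histRV i t ω) *
        histValue (g i) (actionValue g i) t (G.histRV i t ω)) := by
  classical
  have h1 : ∀ ω, f (G.histRV i t ω) * ∑ s ∈ Finset.Ici t, G.rewardRV i s ω =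
      ∑ h, ∑ a, ({ω | G.histRV i t ω = h ∧ G.actionRV t ω i = a} : Set G.Outcome).indicator
        (fun ω => ∑ s ∈ Finset.Ici t, G.rewardRV i s ω) ω * f h := by
    intro ω
    simp only [Set.indicator_apply, Set.mem_ofPred_eq]
    rw [Finset.sum_eq_single (G.histRV i t ω) (by simp +contextual [eq_comm]) (by simp),
      Finset.sum_eq_single (G.actionRV t ω i) (by simp +contextual [eq_comm]) (by simp)]
    simp [mul_comm]
  rw [funext h1, expect_sum, expect_comp g (G.histRV i t) fun h =>
    f h * histValue (g i) (actionValue g i) t h]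
  refine Finset.sum_congr rfl fun h _ => ?_
  rw [expect_sum]
  simp only [histValue, t.isLt, dif_pos, Fin.eta, Finset.mul_sum]
  refine Finset.sum_congr rfl fun a _ => ?_
  rw [expect_mul_const, expect_indicator_eq g _ (abs_sum_rewardRV_le i _), prob_hist_action]
  simp only [actionValue]
  ring

lemma Ici_eq_insert (t : ℕ) (ht : t + 1 < T) : Finset.Ici (⟨t, Nat.lt_of_succ_lt ht⟩ : Fin T) =
    insert ⟨t, Nat.lt_of_succ_lt ht⟩ (Finset.Ici ⟨t + 1, ht⟩) := by
  ext ⟨s, hs⟩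
  simp only [Finset.mem_Ici, Finset.mem_insert, Fin.mk_le_mk, Fin.mk.injEq]
  omega

lemma Ici_last (t : ℕ) (ht : t < T) (ht' : ¬ t + 1 < T) :
    Finset.Ici (⟨t, ht⟩ : Fin T) = {⟨t, ht⟩} := by
  ext ⟨s, hs⟩
  simp only [Finset.mem_Ici, Finset.mem_singleton, Fin.mk_le_mk, Fin.mk.injEq]
  omega

/-- The Bellman equation. -/
lemma actionValue_eq (g : G.Profile) (i : I) (t : Fin T) (h : G.Hist i t) (a : G.U t i) :
    actionValue g i t h a = stageReward g i t h a +
      ∑ z, obsProb g i t h a z * histValue (g i) (actionValue g i) (t + 1) (h, z) := by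
  classical
  obtain ⟨t, ht⟩ := t
  by_cases ht' : t + 1 < T
  · obtain ⟨act, hact⟩ := G.own_action t i
    have h1 := expect_hist_mul_future g i ⟨t + 1, ht'⟩
      fun h' => if h'.1 = h ∧ act h'.2 = a then 1 else 0
    simp only [histRV_succ i t ht', hact] at h1
    set S : Set G.Outcome := {ω | G.histRV i ⟨t, ht⟩ ω = h ∧ G.actionRV ⟨t, ht⟩ ω i = a} with hS
    have e1 : S.indicator (fun ω => ∑ s ∈ Finset.Ici ⟨t, ht⟩, G.rewardRV i s ω) = fun ω =>
        S.indicator (fun ω => G.rewardRV i ⟨t, ht⟩ ω) ω +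
        (if G.histRV i ⟨t, ht⟩ ω = h ∧ G.actionRV ⟨t, ht⟩ ω i = a then 1 else 0) *
          ∑ s ∈ Finset.Ici ⟨t + 1, ht'⟩, G.rewardRV i s ω := by
      ext ω
      rw [Ici_eq_insert t ht']
      simp only [Set.indicator_apply, hS, Set.mem_ofPred_eq]
      rw [Finset.sum_insert (by simp)]
      split_ifs <;> simp
    have e2 : ∀ ω, (if G.histRV i ⟨t, ht⟩ ω = h ∧ G.actionRV ⟨t, ht⟩ ω i = a then (1 : ℝ) else 0) *
        histValue (g i) (actionValue g i) (t + 1) (G.histRV i ⟨t, ht⟩ ω,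
          G.obs t (G.stateRV ⟨t, ht⟩ ω) (G.actionRV ⟨t, ht⟩ ω) (G.noiseRV ⟨t, ht⟩ ω) i) =
        ∑ z, S.indicator (fun ω => if G.obs t (G.stateRV ⟨t, ht⟩ ω) (G.actionRV ⟨t, ht⟩ ω)
          (G.noiseRV ⟨t, ht⟩ ω) i = z then 1 else 0) ω *
          histValue (g i) (actionValue g i) (t + 1) (h, z) := by
      intro ω
      simp only [Set.indicator_apply, hS, Set.mem_ofPred_eq]
      by_cases hω : G.histRV i ⟨t, ht⟩ ω = h ∧ G.actionRV ⟨t, ht⟩ ω i = a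
      · simp [hω]
      · simp [hω]
    have e3 : expect g (S.indicator fun ω => ∑ s ∈ Finset.Ici ⟨t, ht⟩, G.rewardRV i s ω) =
        expect g (S.indicator fun ω => G.rewardRV i ⟨t, ht⟩ ω) + ∑ z, expect g (S.indicator
          fun ω => if G.obs t (G.stateRV ⟨t, ht⟩ ω) (G.actionRV ⟨t, ht⟩ ω)
            (G.noiseRV ⟨t, ht⟩ ω) i = z then 1 else 0) *
          histValue (g i) (actionValue g i) (t + 1) (h, z) := by
      rw [e1, expect_add]
      refine congrArg _ (h1.trans ?_)
      rw [funext e2, expect_sum]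
      exact Finset.sum_congr rfl fun z _ => expect_mul_const _ _ _
    have e4 : actionValue g i ⟨t, ht⟩ h a = expect g (S.indicator fun ω =>
        ∑ s ∈ Finset.Ici ⟨t, ht⟩, G.rewardRV i s ω) / prob g S := rfl
    -- All terms have the denominator Pr(S), so the identity persists as 0 = 0 when `S` is null.
    rw [e4, e3, add_div, Finset.sum_div]
    refine congrArg _ (Finset.sum_congr rfl fun z _ => ?_)
    rw [mul_div_right_comm]
    rfl
  · simp only [histValue, ht', dif_neg, not_false_eq_true, mul_zero, Finset.sum_const_zero,
      add_zero, actionValue, stageReward, Ici_last t ht ht', Finset.sum_singleton]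

end

/-! ### Limits of strategy profiles -/

lemma tendsto_stdSimplex_apply {ι α : Type*} [Fintype α] {l : Filter ι}
    {μ : ι → stdSimplex ℝ α} {ν : stdSimplex ℝ α} (h : Tendsto μ l (𝓝 ν)) (a : α) :
    Tendsto (fun n => μ n a) l (𝓝 (ν a)) :=
  (((continuous_apply a).comp continuous_subtype_val).tendsto ν).comp h

lemma tendsto_profile_apply {gs : ℕ → G.Profile} {g : G.Profile} (h : Tendsto gs atTop (𝓝 g))
    (i : I) (t : Fin T) (h' : G.Hist i t) (a : G.U t i) :
    Tendsto (fun n => gs n i t h' a) atTop (𝓝 (g i t h' a)) :=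
  tendsto_stdSimplex_apply (((h.apply_nhds i).apply_nhds t).apply_nhds h') a

lemma tendsto_pathProb {gs : ℕ → G.Profile} {g : G.Profile} (h : Tendsto gs atTop (𝓝 g)) :
    ∀ t (ht : t ≤ T) (ω : G.Path t),
      Tendsto (fun n => pathProb (gs n) t ht ω) atTop (𝓝 (pathProb g t ht ω))
  | 0, _, _ => tendsto_const_nhds
  | t + 1, ht, ω => ((tendsto_pathProb h t _ ω.1).mul (tendsto_finsetProd _ fun i _ =>
      tendsto_profile_apply h i ⟨t, ht⟩ _ _)).mul_const _

lemma tendsto_payoff {gs : ℕ → G.Profile} {g : G.Profile} (h : Tendsto gs atTop (𝓝 g)) (i : I) :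
    Tendsto (fun n => payoff (gs n) i) atTop (𝓝 (payoff g i)) :=
  tendsto_finsetSum _ fun ω _ => (tendsto_pathProb h T le_rfl ω).mul_const _

/-- Two distributions supported on the maximizers of a function give it the same expectation. -/
lemma sum_eq_of_support_argmax {α : Type*} [Fintype α] (μ ν : stdSimplex ℝ α) (q : α → ℝ)
    (hμ : ∀ a, 0 < μ a → ∀ b, q b ≤ q a) (hν : ∀ a, 0 < ν a → ∀ b, q b ≤ q a) :
    ∑ a, μ a * q a = ∑ a, ν a * q a := by
  have key : ∀ μ ν : stdSimplex ℝ α, (∀ a, 0 < μ a → ∀ b, q b ≤ q a) →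
      ∑ a, ν a * q a ≤ ∑ a, μ a * q a := by
    intro μ ν hμ
    -- Summed over `a` and `b`, this compares the mean of `q` under `ν` with that under `μ`.
    have h : ∀ a b, ν b * (μ a * q b) ≤ ν b * (μ a * q a) := by
      intro a b
      refine mul_le_mul_of_nonneg_left ?_ (stdSimplex.zero_le _ _)
      rcases (stdSimplex.zero_le μ a).eq_or_lt with h0 | h0
      · simp [← h0]
      · exact mul_le_mul_of_nonneg_left (hμ a h0 b) h0.le
    have h' := Finset.sum_le_sum fun a (_ : a ∈ Finset.univ) =>
      Finset.sum_le_sum fun b (_ : b ∈ Finset.univ) => h a b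
    simp only [← Finset.sum_mul, stdSimplex.sum_eq_one, one_mul] at h'
    rw [Finset.sum_comm] at h'
    simpa only [← Finset.mul_sum, ← Finset.sum_mul, stdSimplex.sum_eq_one, one_mul] using h'
  exact le_antisymm (key ν μ hν) (key μ ν hμ)

lemma realizable_of_obsProb_ne_zero {g : G.Profile} {i : I} {t : ℕ} (ht : t + 1 < T)
    {h : G.Hist i t} {a : G.U t i} {z : G.Z t i}
    (hz : obsProb g i ⟨t, Nat.lt_of_succ_lt ht⟩ h a z ≠ 0) :
    G.Realizable i ⟨t + 1, ht⟩ (h, z) := by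
  classical
  refine ⟨g, lt_of_not_ge fun h0 => hz ?_⟩
  have h1 : expect g (({ω | G.histRV i ⟨t, Nat.lt_of_succ_lt ht⟩ ω = h ∧
      G.actionRV ⟨t, Nat.lt_of_succ_lt ht⟩ ω i = a} : Set G.Outcome).indicator fun ω =>
      if G.obs t (G.stateRV ⟨t, Nat.lt_of_succ_lt ht⟩ ω) (G.actionRV ⟨t, Nat.lt_of_succ_lt ht⟩ ω)
        (G.noiseRV ⟨t, Nat.lt_of_succ_lt ht⟩ ω) i = z then 1 else 0) = 0 := by
    refine le_antisymm (le_trans ?_ h0) (expect_nonneg g fun ω =>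
      Set.indicator_nonneg (fun _ _ => by split_ifs <;> simp) _)
    rw [prob_setOf]
    refine expect_mono g fun ω => ?_
    simp only [Set.indicator_apply, Set.mem_ofPred_eq, histRV_succ i t ht]
    split_ifs with c1 c2 c3 <;> first
      | exact absurd (Prod.ext c1.1 c2) c3
      | norm_num
  rw [obsProb, condExpect]
  exact (congrArg (· / _) h1).trans (zero_div _)

/-! ### ### Player `i`'s values in the limit -/

section

variable {i : I} {κ : G.Compression i}
  {F : G.Strategy i → ∀ t : Fin T, κ.K t → stdSimplex ℝ (G.Hist i t)}
  {Φ : G.OtherProfile i → ∀ t : Fin T, κ.K t → stdSimplex ℝ (G.X t × G.OtherHist i t)}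

/-- Both sides integrate the same function against the same value of `Φ`. This serves both to
compare two histories under one profile and to compare two strategies of player `i` at one history.
-/
lemma Compression.FactorsAs.stageReward_congr (hκ : κ.FactorsAs F Φ) {g g' : G.Profile}
    (hg : FullyMixed g) (hg' : FullyMixed g') (hgg' : ∀ j, j ≠ i → g j = g' j) {t : Fin T}
    {h h' : G.Hist i t} (hh : G.Realizable i t h) (hh' : G.Realizable i t h')
    (hk : κ.compress t h = κ.compress t h') (a : G.U t i) :
    stageReward g i t h a = stageReward g' i t h' a := by
  have : (fun j : {j // j ≠ i} => g j) = fun j : {j // j ≠ i} => g' j :=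
    funext fun j => hgg' j j.2
  refine (hκ.condExpect_moves hg t hh a fun x b w => G.reward t x b w i).trans
    (Eq.trans ?_ (hκ.condExpect_moves hg' t hh' a fun x b w => G.reward t x b w i).symm)
  rw [this, hk]

lemma Compression.FactorsAs.obsProb_congr (hκ : κ.FactorsAs F Φ) {g g' : G.Profile}
    (hg : FullyMixed g) (hg' : FullyMixed g') (hgg' : ∀ j, j ≠ i → g j = g' j) {t : Fin T}
    {h h' : G.Hist i t} (hh : G.Realizable i t h) (hh' : G.Realizable i t h')
    (hk : κ.compress t h = κ.compress t h') (a : G.U t i) (z : G.Z t i) :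
    obsProb g i t h a z = obsProb g' i t h' a z := by
  classical
  have : (fun j : {j // j ≠ i} => g j) = fun j : {j // j ≠ i} => g' j :=
    funext fun j => hgg' j j.2
  refine (hκ.condExpect_moves hg t hh a fun x b w => if G.obs t x b w i = z then 1 else 0).trans
    (Eq.trans ?_ (hκ.condExpect_moves hg' t hh' a fun x b w =>
      if G.obs t x b w i = z then 1 else 0).symm)
  rw [this, hk]

lemma tendsto_histValue {ss : ℕ → G.Strategy i} {s : G.Strategy i}
    {qs : ℕ → ∀ t : Fin T, G.Hist i t → G.U t i → ℝ} {q : ∀ t : Fin T, G.Hist i t → G.U t i → ℝ}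
    {t : ℕ} {h : G.Hist i t}
    (hs : ∀ (ht : t < T) a, Tendsto (fun n => ss n ⟨t, ht⟩ h a) atTop (𝓝 (s ⟨t, ht⟩ h a)))
    (hq : ∀ (ht : t < T) a, Tendsto (fun n => qs n ⟨t, ht⟩ h a) atTop (𝓝 (q ⟨t, ht⟩ h a))) :
    Tendsto (fun n => histValue (ss n) (qs n) t h) atTop (𝓝 (histValue s q t h)) := by
  by_cases ht : t < T
  · simp only [histValue, ht, dif_pos]
    exact tendsto_finsetSum _ fun a _ => (hs ht a).mul (hq ht a)
  · simp only [histValue, ht, dif_neg, not_false_eq_true]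
    exact tendsto_const_nhds

lemma tendsto_bellman {t : Fin T} {h : G.Hist i t} {a : G.U t i} {hs : ℕ → G.Profile} {r : ℝ}
    {p : G.Z t i → ℝ} {v : G.Z t i → ℝ}
    (hr : Tendsto (fun n => stageReward (hs n) i t h a) atTop (𝓝 r))
    (hp : ∀ z, Tendsto (fun n => obsProb (hs n) i t h a z) atTop (𝓝 (p z)))
    (hv : ∀ z, (∀ ht : (t : ℕ) + 1 < T, G.Realizable i ⟨t + 1, ht⟩ (h, z)) →
      Tendsto (fun n => histValue (hs n i) (actionValue (hs n) i) (t + 1) (h, z)) atTop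
        (𝓝 (v z))) :
    Tendsto (fun n => actionValue (hs n) i t h a) atTop (𝓝 (r + ∑ z, p z * v z)) := by
  simp only [actionValue_eq]
  refine hr.add (tendsto_finsetSum _ fun z _ => ?_)
  by_cases hz : ∀ ht : (t : ℕ) + 1 < T, G.Realizable i ⟨t + 1, ht⟩ (h, z)
  · exact (hp z).mul (hv z hz)
  -- An observation leading to an unrealizable history has probability zero for every n, so nothing
  -- need be known about its continuation value.
  · have h0 : ∀ n, obsProb (hs n) i t h a z = 0 := fun n => by
      by_contra hne
      exact hz fun ht => realizable_of_obsProb_ne_zero ht hne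
    have h1 : p z = 0 := tendsto_nhds_unique (hp z) (by simp [h0])
    simp [h0, h1]

/-- In the limit only maximizers have positive weight in the compressed strategy, if the values
depend only on the compressed information. -/
lemma Compression.FactorsAs.support_argmax (hκ : κ.FactorsAs F Φ) {gs : ℕ → G.Profile}
    (hgs : ∀ n, FullyMixed (gs n)) {t : Fin T} {q : G.Hist i t → G.U t i → ℝ}
    {s : G.Hist i t → stdSimplex ℝ (G.U t i)}
    (hs : ∀ h a, Tendsto (fun n => gs n i t h a) atTop (𝓝 (s h a)))
    (hopt : ∀ h, G.Realizable i t h → ∀ a, 0 < s h a → ∀ b, q h b ≤ q h a)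
    (hq : ∀ h h', G.Realizable i t h → G.Realizable i t h' →
      κ.compress t h = κ.compress t h' → q h = q h')
    {ρ : κ.K t → stdSimplex ℝ (G.U t i)}
    (hρ : ∀ k a, Tendsto (fun n => averageStrategy (F (gs n i)) (gs n i) t k a) atTop (𝓝 (ρ k a)))
    {h : G.Hist i t} (hh : G.Realizable i t h) (a : G.U t i) (ha : 0 < ρ (κ.compress t h) a)
    (b : G.U t i) : q h b ≤ q h a := by
  classical
  by_contra! hlt
  -- Since `q` depends only on the compression, `a` is suboptimal at all these histories
  -- simultaneously.
  have h0 : ∀ h', G.Realizable i t h' → κ.compress t h' = κ.compress t h → s h' a = 0 := by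
    intro h' hh' hk
    by_contra hne
    have := hopt h' hh' a (lt_of_le_of_ne (stdSimplex.zero_le _ _) (Ne.symm hne)) b
    rw [hq h' h hh' hh hk] at this
    exact this.not_gt hlt
  -- The weights `F (gs n i)` need not converge; only their support and the bound by one are used.
  have h1 : ∀ n, averageStrategy (F (gs n i)) (gs n i) t (κ.compress t h) a ≤
      ∑ h', if G.Realizable i t h' ∧ κ.compress t h' = κ.compress t h
        then gs n i t h' a else 0 := by
    intro n
    have hk : 0 < prob (gs n) {ω | κ.rv t ω = κ.compress t h} :=
      ((hgs n).prob_pos hh).trans_le (prob_mono _ fun ω hω => congrArg (κ.compress t) hω)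
    rw [averageStrategy_apply]
    refine Finset.sum_le_sum fun h' _ => ?_
    rcases (stdSimplex.zero_le (F (gs n i) t (κ.compress t h)) h').eq_or_lt with hF | hF
    · rw [← hF, zero_mul]
      split_ifs
      exacts [stdSimplex.zero_le _ _, le_rfl]
    · obtain ⟨e1, e2⟩ := hκ.compress_eq (gs n) t _ hk h' hF
      rw [if_pos ⟨e2, e1⟩]
      exact mul_le_of_le_one_left (stdSimplex.zero_le _ _) (stdSimplex.le_one _ _)
  have h2 : Tendsto (fun n => ∑ h', if G.Realizable i t h' ∧ κ.compress t h' = κ.compress t h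
      then gs n i t h' a else 0) atTop (𝓝 (∑ _h' : G.Hist i t, (0 : ℝ))) := by
    refine tendsto_finsetSum _ fun h' _ => ?_
    split_ifs with hc
    · exact h0 h' hc.1 hc.2 ▸ hs h' a
    · exact tendsto_const_nhds
  have h3 := le_of_tendsto_of_tendsto' (hρ (κ.compress t h) a) h2 h1
  simp only [Finset.sum_const_zero] at h3
  exact h3.not_gt ha

/-- Both claims are proved together by backward induction: dependence on the compression at the next
time puts the limit `ρ` on maximizers there, so `ρ` and `s` have equal continuation values, and the
Bellman equation passes this back one period. -/
lemma Compression.FactorsAs.actionValue_limit (hκ : κ.FactorsAs F Φ) {gs hs : ℕ → G.Profile}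
    (hgs : ∀ n, FullyMixed (gs n)) (hhs : ∀ n, FullyMixed (hs n))
    (hupd : ∀ n, hs n = Function.update (gs n) i
      (κ.lift (averageStrategy (F (gs n i)) (gs n i))))
    {s : G.Strategy i} {q : ∀ t : Fin T, G.Hist i t → G.U t i → ℝ}
    {ρ : ∀ t : Fin T, κ.K t → stdSimplex ℝ (G.U t i)}
    {r : ∀ t : Fin T, G.Hist i t → G.U t i → ℝ}
    {p : ∀ t : Fin T, G.Hist i t → G.U t i → G.Z t i → ℝ}
    (hs_lim : ∀ t h a, Tendsto (fun n => gs n i t h a) atTop (𝓝 (s t h a)))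
    (hopt : ∀ t h, G.Realizable i t h → ∀ a, 0 < s t h a → ∀ b, q t h b ≤ q t h a)
    (hq : ∀ t h a, G.Realizable i t h →
      Tendsto (fun n => actionValue (gs n) i t h a) atTop (𝓝 (q t h a)))
    (hρ : ∀ t k a, Tendsto (fun n => averageStrategy (F (gs n i)) (gs n i) t k a) atTop
      (𝓝 (ρ t k a)))
    (hr : ∀ t h a, Tendsto (fun n => stageReward (gs n) i t h a) atTop (𝓝 (r t h a)))
    (hp : ∀ t h a z, Tendsto (fun n => obsProb (gs n) i t h a z) atTop (𝓝 (p t h a z)))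
    (t : Fin T) : (∀ h h', G.Realizable i t h → G.Realizable i t h' →
        κ.compress t h = κ.compress t h' → q t h = q t h') ∧
      ∀ h a, G.Realizable i t h →
        Tendsto (fun n => actionValue (hs n) i t h a) atTop (𝓝 (q t h a)) := by
  induction hm : T - (t : ℕ) using Nat.strong_induction_on generalizing t with
  | _ m ih =>
  subst hm
  have hoth : ∀ n, ∀ j, j ≠ i → hs n j = gs n j := fun n j hj => by
    rw [hupd n, Function.update_of_ne hj]
  have hown : ∀ n t h a, hs n i t h a =
      averageStrategy (F (gs n i)) (gs n i) t (κ.compress t h) a := fun n t h a => by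
    rw [hupd n, Function.update_self]; rfl
  replace ih : ∀ ht : (t : ℕ) + 1 < T, _ := fun ht => ih _ (by simp only; omega) ⟨t + 1, ht⟩ rfl
  have hval : ∀ (ht : (t : ℕ) + 1 < T) h, G.Realizable i ⟨t + 1, ht⟩ h →
      histValue (κ.lift ρ) q (t + 1) h = histValue s q (t + 1) h := by
    intro ht h hh
    simp only [histValue, ht, dif_pos]
    exact sum_eq_of_support_argmax _ _ _ (hκ.support_argmax hgs (hs_lim _) (hopt _) (ih ht).1
      (hρ _) hh) (hopt _ h hh)
  have hq_eq : ∀ h a, G.Realizable i t h → q t h a =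
      r t h a + ∑ z, p t h a z * histValue s q (t + 1) (h, z) := fun h a hh =>
    tendsto_nhds_unique (hq t h a hh) (tendsto_bellman (hr t h a) (hp t h a) fun z hz =>
      tendsto_histValue (fun ht a => hs_lim _ _ a) fun ht a => hq _ _ a (hz ht))
  refine ⟨fun h h' hh hh' hk => funext fun a => ?_, fun h a hh => ?_⟩
  · rw [hq_eq h a hh, hq_eq h' a hh']
    have er : r t h a = r t h' a := tendsto_nhds_unique (hr t h a) ((hr t h' a).congr fun n =>
      hκ.stageReward_congr (hgs n) (hgs n) (fun _ _ => rfl) hh' hh hk.symm a)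
    have ep : ∀ z, p t h a z = p t h' a z := fun z => tendsto_nhds_unique (hp t h a z)
      ((hp t h' a z).congr fun n =>
      hκ.obsProb_congr (hgs n) (hgs n) (fun _ _ => rfl) hh' hh hk.symm a z)
    rw [er]
    refine congrArg _ (Finset.sum_congr rfl fun z _ => ?_)
    rw [ep z]
    by_cases ht : (t : ℕ) + 1 < T
    · by_cases hz : G.Realizable i ⟨t + 1, ht⟩ (h, z) ∧ G.Realizable i ⟨t + 1, ht⟩ (h', z)
      · have hk' : κ.compress (t + 1) (h, z) = κ.compress (t + 1) (h', z) :=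
          congrArg (κ.update t · z) hk
        have e := (ih ht).1 _ _ hz.1 hz.2 hk'
        refine congrArg _ ?_
        simp only [histValue, ht, dif_pos]
        rw [e]
        exact sum_eq_of_support_argmax _ _ _ (e ▸ hopt _ _ hz.1) (hopt _ _ hz.2)
      -- If either extension by `z` is unrealizable, the limiting probability of `z` vanishes there,
      -- hence at both histories by `ep`.
      · have hp0 : p t h' a z = 0 := by
          by_cases hz1 : G.Realizable i ⟨t + 1, ht⟩ (h, z)
          · have h0 : ∀ n, obsProb (gs n) i t h' a z = 0 := fun n => by
              by_contra hne
              exact hz ⟨hz1, realizable_of_obsProb_ne_zero ht hne⟩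
            exact tendsto_nhds_unique (hp t h' a z) (by simp [h0])
          · have h0 : ∀ n, obsProb (gs n) i t h a z = 0 := fun n => by
              by_contra hne
              exact hz1 (realizable_of_obsProb_ne_zero ht hne)
            rw [← ep z]
            exact tendsto_nhds_unique (hp t h a z) (by simp [h0])
        rw [hp0, zero_mul, zero_mul]
    · simp [histValue, ht]
  · rw [hq_eq h a hh]
    refine tendsto_bellman ((hr t h a).congr fun n => ?_) (fun z => (hp t h a z).congr fun n => ?_)
      fun z hz => ?_
    · exact hκ.stageReward_congr (hgs n) (hhs n) (fun j hj => (hoth n j hj).symm) hh hh rfl a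
    · exact hκ.obsProb_congr (hgs n) (hhs n) (fun j hj => (hoth n j hj).symm) hh hh rfl a z
    · have := tendsto_histValue (ss := fun n => hs n i) (s := κ.lift ρ)
        (qs := fun n => actionValue (hs n) i) (q := q) (t := t + 1) (h := (h, z))
        (fun ht b => (hρ ⟨t + 1, ht⟩ (κ.compress (t + 1) (h, z)) b).congr fun n =>
          (hown n ⟨t + 1, ht⟩ (h, z) b).symm)
        (fun ht b => (ih ht).2 _ b (hz ht))
      by_cases ht : (t : ℕ) + 1 < T
      · rwa [hval ht _ (hz ht)] at this
      · simp [histValue, ht]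

end

/-! ### ### Replacing the strategies player by player -/

/-- The strategy of one player can be replaced by a strategy that uses only unilaterally
sufficient information. -/
theorem IsSequentialEquilibrium.exists_replace {g : G.Profile} {Q : G.ValueFunctions}
    (hE : IsSequentialEquilibrium g Q) {i : I} {κ : G.Compression i} (hκ : κ.IsUSI) :
    ∃ ρ : ∀ t : Fin T, κ.K t → stdSimplex ℝ (G.U t i),
      IsSequentialEquilibrium (Function.update g i (κ.lift ρ)) Q ∧
        payoff (Function.update g i (κ.lift ρ)) = payoff g := by
  classical
  obtain ⟨F, Φ, hF⟩ := hκ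
  replace hF : κ.FactorsAs F Φ := hF
  obtain ⟨hrat, gs₀, Qs₀, hmix₀, hcons₀, hlim₀⟩ := hE
  have hIcc : ∀ (g : G.Profile) (A : Set G.Outcome) (φ : G.Outcome → ℝ), (∀ ω, |φ ω| ≤ 1) →
      condExpect g φ A ∈ Set.Icc (-1 : ℝ) 1 := fun g A φ h =>
    abs_le.1 (abs_condExpect_le g A zero_le_one h)
  -- Everything whose convergence is not given is collected in one compact product of simplices and
  -- intervals.
  let x : ℕ → (∀ t : Fin T, κ.K t → stdSimplex ℝ (G.U t i)) ×
      (∀ t : Fin T, G.Hist i t → G.U t i → Set.Icc (-1 : ℝ) 1) ×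
      (∀ t : Fin T, G.Hist i t → G.U t i → G.Z t i → Set.Icc (-1 : ℝ) 1) := fun n =>
    (averageStrategy (F (gs₀ n i)) (gs₀ n i),
      fun t h a => ⟨stageReward (gs₀ n) i t h a, hIcc _ _ _ (abs_rewardRV_le i t)⟩,
      fun t h a z => ⟨obsProb (gs₀ n) i t h a z, hIcc _ _ _ fun ω => by split_ifs <;> simp⟩)
  obtain ⟨⟨ρ, r, p⟩, φ, hφ, hx⟩ := CompactSpace.tendsto_subseq x
  set gs : ℕ → G.Profile := fun n => gs₀ (φ n) with hgs_def
  set Qs : ℕ → G.ValueFunctions := fun n => Qs₀ (φ n) with hQs_def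
  have hmix : ∀ n, FullyMixed (gs n) := fun n => hmix₀ _
  have hcons : ∀ n, Consistent (gs n) (Qs n) := fun n => hcons₀ _
  have hlim : Tendsto (fun n => (gs n, Qs n)) atTop (𝓝 (g, Q)) := hlim₀.comp hφ.tendsto_atTop
  have hg : Tendsto gs atTop (𝓝 g) := hlim.fst_nhds
  have hQ : Tendsto Qs atTop (𝓝 Q) := hlim.snd_nhds
  have hρ : Tendsto (fun n => averageStrategy (F (gs n i)) (gs n i)) atTop (𝓝 ρ) := hx.fst_nhds
  have hr : ∀ t h a, Tendsto (fun n => stageReward (gs n) i t h a) atTop (𝓝 (r t h a)) :=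
    fun t h a => (continuous_subtype_val.tendsto _).comp
      (((hx.snd_nhds.fst_nhds.apply_nhds t).apply_nhds h).apply_nhds a)
  have hp : ∀ t h a z, Tendsto (fun n => obsProb (gs n) i t h a z) atTop (𝓝 (p t h a z)) :=
    fun t h a z => (continuous_subtype_val.tendsto _).comp
      ((((hx.snd_nhds.snd_nhds.apply_nhds t).apply_nhds h).apply_nhds a).apply_nhds z)
  have hQa : ∀ j t h a, Tendsto (fun n => Qs n j t h a) atTop (𝓝 (Q j t h a)) :=
    fun j t h a => (((hQ.apply_nhds j).apply_nhds t).apply_nhds h).apply_nhds a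
  have hρa : ∀ t k a, Tendsto (fun n => averageStrategy (F (gs n i)) (gs n i) t k a) atTop
      (𝓝 (ρ t k a)) := fun t k a => tendsto_stdSimplex_apply ((hρ.apply_nhds t).apply_nhds k) a
  set hs : ℕ → G.Profile := fun n => Function.update (gs n) i
    (κ.lift (averageStrategy (F (gs n i)) (gs n i))) with hhs
  have hmix' : ∀ n, FullyMixed (hs n) := by
    intro n j t h a
    by_cases hj : j = i
    · subst hj
      simp only [hhs, Function.update_self]
      exact averageStrategy_pos _ (hmix n j) t _ a
    · simp only [hhs, Function.update_of_ne hj]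
      exact hmix n j t h a
  have hlim' : Tendsto hs atTop (𝓝 (Function.update g i (κ.lift ρ))) := by
    refine hg.update i (tendsto_pi_nhds.2 fun t => tendsto_pi_nhds.2 fun h => ?_)
    exact (hρ.apply_nhds t).apply_nhds (κ.compress t h)
  have hval := hF.actionValue_limit (s := g i) (q := Q i) hmix hmix' (fun _ => rfl)
    (tendsto_profile_apply hg i) (hrat i)
    (fun t h a hh => (hQa i t h a).congr fun n => hcons n i t h hh a) hρa hr hp
  -- Consistency says nothing at unrealizable histories; keeping `Qs n` there secures convergence to
  -- `Q`.
  refine ⟨ρ, ⟨?_, hs, fun n j t h a => if j = i ∧ G.Realizable j t h then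
      actionValue (hs n) j t h a else Qs n j t h a, hmix', ?_, hlim'.prodMk_nhds ?_⟩, ?_⟩
  · intro j t h hh a ha b
    by_cases hj : j = i
    · subst hj
      rw [Function.update_self] at ha
      exact hF.support_argmax hmix (tendsto_profile_apply hg j t) (hrat j t) (hval t).1 (hρa t)
        hh a ha b
    · rw [Function.update_of_ne hj] at ha
      exact hrat j t h hh a ha b
  · intro n j t h hh a
    by_cases hj : j = i
    · simp only [hj, true_and]
      subst hj
      rw [if_pos hh]
      rfl
    · simp only [hj, false_and, if_false]
      rw [hcons n j t h hh a]
      exact (hF.condExpect_replace (gs n) hj t h a).symm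
  · refine tendsto_pi_nhds.2 fun j => tendsto_pi_nhds.2 fun t => tendsto_pi_nhds.2 fun h =>
      tendsto_pi_nhds.2 fun a => ?_
    by_cases hc : j = i ∧ G.Realizable j t h
    · simp only [hc, and_self, if_true]
      obtain ⟨rfl, hh⟩ := hc
      simpa only [hh, and_self, if_true] using (hval t).2 h a hh
    · simp only [hc, if_false]
      exact hQa j t h a
  · ext j
    exact tendsto_nhds_unique (tendsto_payoff hlim' j)
      ((tendsto_payoff hg j).congr fun n => (hF.payoff_replace (gs n) j).symm)

theorem IsSequentialEquilibrium.exists_isBased {g : G.Profile} {Q : G.ValueFunctions}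
    (hE : IsSequentialEquilibrium g Q) (κ : ∀ i, G.Compression i) (hκ : ∀ i, (κ i).IsUSI)
    (s : Finset I) : ∃ g' : G.Profile, (∀ i ∈ s, (κ i).IsBased (g' i)) ∧
      IsSequentialEquilibrium g' Q ∧ payoff g' = payoff g := by
  induction s using Finset.induction_on with
  | empty => exact ⟨g, by simp, hE, rfl⟩
  | insert i s _ ih =>
    obtain ⟨g₁, hb, hE₁, hp₁⟩ := ih
    -- Only player `i`'s strategy changes, so the strategies already compressed stay so.
    obtain ⟨ρ, hE₂, hp₂⟩ := hE₁.exists_replace (hκ i)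
    refine ⟨_, fun j hj => ?_, hE₂, hp₂.trans hp₁⟩
    by_cases hji : j = i
    · subst hji
      rw [Function.update_self]
      exact ⟨ρ, fun _ _ => rfl⟩
    · rw [Function.update_of_ne hji]
      exact hb j ((Finset.mem_insert.1 hj).resolve_left hji)

end DynGame

theorem theorem4 {I : Type v} [Fintype I] [DecidableEq I] {T : ℕ} (G : DynGame.{u, v} I T)
    (κ : ∀ i, G.Compression i) (hκ : ∀ i, (κ i).IsUSI) :
    DynGame.basedSEPayoffs κ = DynGame.sePayoffs G := by
  ext v
  constructor
  · rintro ⟨g, Q, -, hE, hv⟩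
    exact ⟨g, Q, hE, hv⟩
  · rintro ⟨g, Q, hE, hv⟩
    obtain ⟨g', hb, hE', hp⟩ := hE.exists_isBased κ hκ Finset.univ
    exact ⟨g', Q, fun i => hb i (Finset.mem_univ i), hE', hp.trans hv⟩
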